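/- Let $n\ge 1$, let $A=(a_{ij})$ be an $n\times n$ real matrix with non-negative entries, and let $\operatorname{per}A=\sum_{\sigma\in S_n}\prod_{i=1}^n a_{i\sigma(i)}$ be its permanent. Let $u_{ij}$, $1\le i,j\le n$, be independent standard Gaussian random variables (mean $0$, variance $1$), let $B=(b_{ij})$ with $b_{ij}=u_{ij}\sqrt{a_{ij}}$, and let $\alpha=(\det B)^2$. Then: (1) $\alpha$ is integrable and its expectation is $\operatorname{per}A$. (2) If $\operatorname{per}A>0$, then for every $C>1$, $$\mathbf P\big(\alpha\ge C\cdot\operatorname{per}A\big)\le C^{-1}.$$ (3) Let $$c_0=\exp\left\{\frac{4}{\sqrt{2\pi}}\int_0^{+\infty}(\ln t)\,e^{-t^2/2}\,dt\right\}\approx 0.2807297419,$$ where the integral converges absolutely and the numerical value is meant up to an error smaller than $10^{-9}$. If $\operatorname{per}A>0$, then for every $\epsilon$ with $0<\epsilon<1$, $$\mathbf P\big(\alpha\le(\epsilon c_0)^n\operatorname{per}A\big)\le\frac{8}{n\ln^2\epsilon}.$$ -/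

import Mathlib

open MeasureTheory ProbabilityTheory

noncomputable section

/-- The random matrix `B = (u_ij √a_ij)` built from the input matrix `A` and the sampled
numbers `u`. -/
def gaussianScaledMatrix {n : ℕ} (A : Matrix (Fin n) (Fin n) ℝ) (u : Fin n → Fin n → ℝ) :
    Matrix (Fin n) (Fin n) ℝ :=
  Matrix.of fun i j => u i j * √(A i j)

/-- The output `α = (det B)²` of the permanent approximation algorithm. -/
def permEstimator {n : ℕ} (A : Matrix (Fin n) (Fin n) ℝ) (u : Fin n → Fin n → ℝ) : ℝ :=
  (gaussianScaledMatrix A u).det ^ 2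

/-- The function `t ↦ (ln t) e^{-t²/2}` whose integral over `(0, ∞)` enters `c₀`. -/
def logGaussianIntegrand (t : ℝ) : ℝ :=
  Real.log t * Real.exp (-t ^ 2 / 2)

/-- The constant `c₀ = exp ((4 / √(2π)) ∫₀^∞ (ln t) e^{-t²/2} dt)`. -/
def permConstant : ℝ :=
  Real.exp (4 / √(2 * Real.pi) * ∫ t in Set.Ioi (0 : ℝ), logGaussianIntegrand t)

end

/-! ### Numerical bounds for Euler's constant. -/

section EulerMascheroni

open Filter Topology Set

/-! The determinant of `B` is a multilinear form in the rows of `u`. Its coefficient at a tuple of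
basis vectors vanishes unless the tuple is a permutation `σ`, and then its square is `∏ a_{iσ(i)}`;
so the squared coefficients sum to `per A`. Everything is proved for sums of squares of a finite
family of multilinear forms, by exposing one Gaussian row at a time: fixing the first row leaves
forms in fewer rows, whose squared coefficients sum to a quadratic form in that row, with mean the
old sum. Iterating gives the expectation, and Markov's inequality the upper tail.

For the lower tail, `log c₀` is the mean of `log Y²` for a standard Gaussian `Y`. The potential is
the squared positive part of `b - log t`. A normalised quadratic form is a convex combination of
squares of possibly dependent standard Gaussians, so concavity of `log` bounds its logarithm below
by an average of terms with mean `log c₀`. Hence one row shifts the threshold by `log c₀` and costs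
at most 8 (`lintegral_logDeficitSq_sum_linearMap_sq_le`); `n` rows cost `8n`
(`lintegral_logDeficitSq_sumSqForms_le`). Markov at level `(n ln ε)²` concludes.

The digits of `c₀` come from `c₀ = exp(-γ)/2`, a form of the value of `Γ'(1/2)`, and Euler–Maclaurin
bounds for `γ`. -/

theorem tendsto_harmonic_increment {r : ℝ → ℝ} (hr : Tendsto r atTop (𝓝 0)) :
    Tendsto (fun x : ℝ => 1 / (x + 1) - Real.log (x + 1) + Real.log x + r x - r (x + 1)) atTop
      (𝓝 0) := by
  have hshift : Tendsto (fun x : ℝ => x + 1) atTop atTop :=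
    tendsto_atTop_add_const_right _ _ tendsto_id
  have h1 : Tendsto (fun x : ℝ => 1 / (x + 1)) atTop (𝓝 0) :=
    tendsto_const_nhds.div_atTop hshift
  have h2 := Real.tendsto_log_comp_add_sub_log 1
  have h3 := ((h1.sub h2).add hr).sub (hr.comp hshift)
  simp only [sub_zero, add_zero] at h3
  refine h3.congr fun x => ?_
  simp only [Function.comp]
  ring

theorem tendsto_harmonic_sub_log_sub {r : ℝ → ℝ} (hr : Tendsto r atTop (𝓝 0)) (n : ℕ) :
    Tendsto (fun k : ℕ =>
      (harmonic (n + k) : ℝ) - Real.log ((n + k : ℕ) : ℝ) - r ((n + k : ℕ) : ℝ)) atTop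
      (𝓝 Real.eulerMascheroniConstant) := by
  have h := Real.tendsto_harmonic_sub_log.sub (hr.comp tendsto_natCast_atTop_atTop)
  rw [sub_zero] at h
  exact h.comp (tendsto_atTop_mono (fun k => by simp) tendsto_id)

/-- If the correction `r` tends to `0` at infinity and the increment
`1 / (x + 1) - log (x + 1) + log x + r x - r (x + 1)` is antitone, then `H n - log n - r n` is at
most Euler's constant. -/
theorem harmonic_sub_log_sub_le_eulerMascheroniConstant {r : ℝ → ℝ} (hr : Tendsto r atTop (𝓝 0))
    (hanti : AntitoneOn
      (fun x : ℝ => 1 / (x + 1) - Real.log (x + 1) + Real.log x + r x - r (x + 1)) (Ioi 0))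
    {n : ℕ} (hn : 1 ≤ n) :
    (harmonic n : ℝ) - Real.log n - r n ≤ Real.eulerMascheroniConstant := by
  have hmono : Monotone fun k : ℕ =>
      (harmonic (n + k) : ℝ) - Real.log ((n + k : ℕ) : ℝ) - r ((n + k : ℕ) : ℝ) := by
    refine monotone_nat_of_le_succ fun k => ?_
    have hk : (0 : ℝ) < ((n + k : ℕ) : ℝ) := by exact_mod_cast (by omega : 0 < n + k)
    have := le_of_tendsto (tendsto_harmonic_increment hr)
      ((eventually_ge_atTop ((n + k : ℕ) : ℝ)).mono fun y hy => hanti hk (hk.trans_le hy) hy)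
    rw [← add_assoc, harmonic_succ]
    push_cast at this ⊢
    rw [one_div] at this
    linarith
  simpa using hmono.ge_of_tendsto (tendsto_harmonic_sub_log_sub hr n) 0

/-- The reversed form of `harmonic_sub_log_sub_le_eulerMascheroniConstant`. -/
theorem eulerMascheroniConstant_le_harmonic_sub_log_sub {r : ℝ → ℝ} (hr : Tendsto r atTop (𝓝 0))
    (hmono : MonotoneOn
      (fun x : ℝ => 1 / (x + 1) - Real.log (x + 1) + Real.log x + r x - r (x + 1)) (Ioi 0))
    {n : ℕ} (hn : 1 ≤ n) :
    Real.eulerMascheroniConstant ≤ (harmonic n : ℝ) - Real.log n - r n := by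
  have hanti : Antitone fun k : ℕ =>
      (harmonic (n + k) : ℝ) - Real.log ((n + k : ℕ) : ℝ) - r ((n + k : ℕ) : ℝ) := by
    refine antitone_nat_of_succ_le fun k => ?_
    have hk : (0 : ℝ) < ((n + k : ℕ) : ℝ) := by exact_mod_cast (by omega : 0 < n + k)
    have := ge_of_tendsto (tendsto_harmonic_increment hr)
      ((eventually_ge_atTop ((n + k : ℕ) : ℝ)).mono fun y hy => hmono hk (hk.trans_le hy) hy)
    rw [← add_assoc, harmonic_succ]
    push_cast at this ⊢
    rw [one_div] at this
    linarith
  simpa using hanti.le_of_tendsto (tendsto_harmonic_sub_log_sub hr n) 0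

theorem hasDerivAt_const_div_pow (c : ℝ) (k : ℕ) {x : ℝ} (hx : x ≠ 0) :
    HasDerivAt (fun y : ℝ => c / y ^ (k + 1)) (-(c * (k + 1)) / x ^ (k + 2)) x := by
  have h := ((hasDerivAt_pow (k + 1) x).inv (pow_ne_zero _ hx)).const_mul c
  convert! h using 1
  field_simp
  push_cast
  ring

theorem hasDerivAt_harmonic_increment {r r' : ℝ → ℝ} (hr : ∀ x, 0 < x → HasDerivAt r (r' x) x)
    {x : ℝ} (hx : 0 < x) :
    HasDerivAt (fun x : ℝ => 1 / (x + 1) - Real.log (x + 1) + Real.log x + r x - r (x + 1))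
      (-1 / (x + 1) ^ 2 - 1 / (x + 1) + 1 / x + r' x - r' (x + 1)) x := by
  have hx1 : 0 < x + 1 := by linarith
  have hid : HasDerivAt (fun y : ℝ => y + 1) 1 x := (hasDerivAt_id x).add_const 1
  have h1 : HasDerivAt (fun y : ℝ => 1 / (y + 1)) (-1 / (x + 1) ^ 2) x := by
    convert! hid.inv hx1.ne' using 1; ext; simp
  have h2 : HasDerivAt (fun y : ℝ => Real.log (y + 1)) (1 / (x + 1)) x := hid.log hx1.ne'
  have h3 : HasDerivAt Real.log (1 / x) x := by simpa using Real.hasDerivAt_log hx.ne'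
  have h4 : HasDerivAt (fun y : ℝ => r (y + 1)) (r' (x + 1)) x := by
    simpa [Function.comp_def] using (hr (x + 1) hx1).comp x hid
  exact (((h1.sub h2).add h3).add (hr x hx)).sub h4

/-- The correction is the Euler–Maclaurin expansion cut after `x⁻⁴`; cutting one term later, in
`eulerMascheroniConstant_upper`, reverses the inequality. -/
theorem eulerMascheroniConstant_lower {n : ℕ} (hn : 1 ≤ n) :
    (harmonic n : ℝ) - Real.log n
      - (1 / 2 / (n : ℝ) ^ 1 + (-1 / 12) / (n : ℝ) ^ 2 + 1 / 120 / (n : ℝ) ^ 4)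
      ≤ Real.eulerMascheroniConstant := by
  refine harmonic_sub_log_sub_le_eulerMascheroniConstant
    (r := fun x => 1 / 2 / x ^ 1 + (-1 / 12) / x ^ 2 + 1 / 120 / x ^ 4) ?_ ?_ hn
  · have h : ∀ (c : ℝ) (k : ℕ), k ≠ 0 → Tendsto (fun x : ℝ => c / x ^ k) atTop (𝓝 0) :=
      fun c k hk => tendsto_const_nhds.div_atTop (tendsto_pow_atTop hk)
    simpa using ((h (1 / 2) 1 (by simp)).add (h (-1 / 12) 2 (by simp))).add (h (1 / 120) 4 (by simp))
  · have hd : ∀ x : ℝ, 0 < x → HasDerivAt _ _ x := fun x hx => hasDerivAt_harmonic_increment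
      (fun y hy => ((hasDerivAt_const_div_pow (1 / 2) 0 hy.ne').add
        (hasDerivAt_const_div_pow (-1 / 12) 1 hy.ne')).add
        (hasDerivAt_const_div_pow (1 / 120) 3 hy.ne')) hx
    refine antitoneOn_of_deriv_nonpos (convex_Ioi 0)
      (fun x hx => (hd x hx).continuousAt.continuousWithinAt)
      (fun x hx => (hd x (by simpa using hx)).differentiableAt.differentiableWithinAt) fun x hx => ?_
    rw [interior_Ioi] at hx
    have hx : 0 < x := hx
    refine (hd x hx).deriv.trans_le ?_
    -- This is minus the derivative of the increment over a common denominator; all coefficients of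
    -- the numerator are positive.
    have : 0 ≤ (1 / 30 + x / 6 + x ^ 2 / 6) / (x ^ 5 * (x + 1) ^ 5) := by positivity
    refine le_of_eq_of_le ?_ (neg_nonpos.2 this)
    have hx1 : x + 1 ≠ 0 := by positivity
    norm_num
    field_simp
    ring

theorem eulerMascheroniConstant_upper {n : ℕ} (hn : 1 ≤ n) :
    Real.eulerMascheroniConstant ≤ (harmonic n : ℝ) - Real.log n
      - (1 / 2 / (n : ℝ) ^ 1 + (-1 / 12) / (n : ℝ) ^ 2 + 1 / 120 / (n : ℝ) ^ 4
        + (-1 / 252) / (n : ℝ) ^ 6) := by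
  refine eulerMascheroniConstant_le_harmonic_sub_log_sub
    (r := fun x => 1 / 2 / x ^ 1 + (-1 / 12) / x ^ 2 + 1 / 120 / x ^ 4 + (-1 / 252) / x ^ 6) ?_ ?_ hn
  · have h : ∀ (c : ℝ) (k : ℕ), k ≠ 0 → Tendsto (fun x : ℝ => c / x ^ k) atTop (𝓝 0) :=
      fun c k hk => tendsto_const_nhds.div_atTop (tendsto_pow_atTop hk)
    simpa using (((h (1 / 2) 1 (by simp)).add (h (-1 / 12) 2 (by simp))).add
      (h (1 / 120) 4 (by simp))).add (h (-1 / 252) 6 (by simp))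
  · have hd : ∀ x : ℝ, 0 < x → HasDerivAt _ _ x := fun x hx => hasDerivAt_harmonic_increment
      (fun y hy => (((hasDerivAt_const_div_pow (1 / 2) 0 hy.ne').add
        (hasDerivAt_const_div_pow (-1 / 12) 1 hy.ne')).add
        (hasDerivAt_const_div_pow (1 / 120) 3 hy.ne')).add
        (hasDerivAt_const_div_pow (-1 / 252) 5 hy.ne')) hx
    refine monotoneOn_of_deriv_nonneg (convex_Ioi 0)
      (fun x hx => (hd x hx).continuousAt.continuousWithinAt)
      (fun x hx => (hd x (by simpa using hx)).differentiableAt.differentiableWithinAt) fun x hx => ?_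
    rw [interior_Ioi] at hx
    have hx : 0 < x := hx
    refine le_of_le_of_eq ?_ (hd x hx).deriv.symm
    have : 0 ≤ (1 / 42 + x / 6 + 7 / 15 * x ^ 2 + 3 / 5 * x ^ 3 + 3 / 10 * x ^ 4)
        / (x ^ 7 * (x + 1) ^ 7) := by positivity
    refine le_of_le_of_eq this ?_
    have hx1 : x + 1 ≠ 0 := by positivity
    norm_num
    field_simp
    ring

theorem eulerMascheroniConstant_bounds :
    0.577215663 ≤ Real.eulerMascheroniConstant ∧ Real.eulerMascheroniConstant ≤ 0.577215667 := by
  -- At `n = 16` the two bounds differ by `1/(252·16⁶) < 3·10⁻¹⁰`, and `log 16 = 4 log 2` needs only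
  -- the known digits of `log 2`.
  have hl := eulerMascheroniConstant_lower (n := 16) (by norm_num)
  have hu := eulerMascheroniConstant_upper (n := 16) (by norm_num)
  have hlog : Real.log ((16 : ℕ) : ℝ) = 4 * Real.log 2 := by
    rw [show ((16 : ℕ) : ℝ) = 2 ^ 4 by norm_num, Real.log_pow]; norm_num
  have hH : (harmonic 16 : ℝ) = 2436559 / 720720 := by
    have : harmonic 16 = 2436559 / 720720 := by
      simp only [harmonic, Finset.sum_range_succ, Finset.sum_range_zero]; norm_num
    rw [this]; norm_num
  have h2 := abs_le.1 Real.log_two_near_10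
  rw [hlog, hH] at hl hu
  norm_num at hl hu h2 ⊢
  constructor <;> linarith [h2.1, h2.2]

theorem exp_neg_eulerMascheroniConstant_bounds :
    0.561459482 < Real.exp (-Real.eulerMascheroniConstant) ∧
      Real.exp (-Real.eulerMascheroniConstant) < 0.561459485 := by
  obtain ⟨hl, hu⟩ := eulerMascheroniConstant_bounds
  have key : ∀ x : ℝ, |x| ≤ 1 → |Real.exp x - ∑ m ∈ Finset.range 13, x ^ m / m.factorial| ≤
      |x| ^ 13 * ((13 : ℕ).succ / ((13 : ℕ).factorial * (13 : ℕ))) := fun x hx =>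
    Real.exp_bound hx (by norm_num)
  constructor
  · have h := key (-0.577215667) (by norm_num [abs_le])
    have := Real.exp_le_exp.2 (neg_le_neg hu)
    refine lt_of_lt_of_le ?_ this
    have := (abs_le.1 h).1
    norm_num [Finset.sum_range_succ, Nat.factorial, abs_of_neg] at this ⊢
    linarith
  · have h := key (-0.577215663) (by norm_num [abs_le])
    have := Real.exp_le_exp.2 (neg_le_neg hl)
    refine lt_of_le_of_lt this ?_
    have := (abs_le.1 h).2
    norm_num [Finset.sum_range_succ, Nat.factorial, abs_of_neg] at this ⊢
    linarith

end EulerMascheroni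

/-! ### The integral of `ln t · exp(-t²/2)` and the value of `c₀`. -/

section LogGaussianIntegral

open Set Filter Topology

/-- Two expressions for `Γ'(1/2)` are compared: differentiation under Euler's integral, and the
closed form. -/
theorem integral_rpow_neg_half_mul_log_mul_exp_neg :
    ∫ t : ℝ in Ioi 0, t ^ (-(1 / 2) : ℝ) * (Real.log t * Real.exp (-t)) =
      -√Real.pi * (Real.eulerMascheroniConstant + 2 * Real.log 2) := by
  have h1 := Complex.hasDerivAt_GammaIntegral (s := 1 / 2) (by norm_num)
  have h2 : HasDerivAt Complex.GammaIntegral _ (1 / 2) :=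
    Complex.hasDerivAt_Gamma_one_half.congr_of_eventuallyEq (by
      have : ∀ᶠ s : ℂ in 𝓝 (1 / 2), 0 < s.re :=
        (isOpen_lt continuous_const Complex.continuous_re).mem_nhds (by norm_num)
      filter_upwards [this] with s hs
      exact (Complex.Gamma_eq_integral hs).symm)
  have h := h1.unique h2
  have h3 : ∫ t : ℝ in Ioi 0, (t : ℂ) ^ ((1 / 2 : ℂ) - 1) * (Real.log t * Real.exp (-t)) =
      ((∫ t : ℝ in Ioi 0, t ^ (-(1 / 2) : ℝ) * (Real.log t * Real.exp (-t)) : ℝ) : ℂ) := by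
    rw [← integral_complex_ofReal]
    refine setIntegral_congr_fun measurableSet_Ioi fun t ht => ?_
    simp only [Complex.ofReal_mul]
    rw [Complex.ofReal_cpow (le_of_lt ht)]
    norm_num
  rw [h3] at h
  have h4 : Complex.log 2 = ((Real.log 2 : ℝ) : ℂ) := by
    rw [Complex.ofReal_log (by norm_num)]; norm_num
  rw [h4] at h
  exact_mod_cast h

theorem integral_exp_neg_sq_div_two :
    ∫ t : ℝ in Ioi 0, Real.exp (-t ^ 2 / 2) = √(2 * Real.pi) / 2 := by
  have h := integral_gaussian_Ioi (1 / 2)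
  rw [show Real.pi / (1 / 2) = 2 * Real.pi by ring] at h
  rw [← h]
  congr! 3 with t
  ring

theorem integrable_exp_neg_sq_div_two : Integrable fun t : ℝ => Real.exp (-t ^ 2 / 2) := by
  refine (integrable_exp_neg_mul_sq (b := 1 / 2) (by norm_num)).congr (ae_of_all _ fun t => ?_)
  simp only
  congr 1
  ring

theorem integrable_mul_exp_neg_sq_div_two : Integrable fun t : ℝ => t * Real.exp (-t ^ 2 / 2) := by
  refine (integrable_mul_exp_neg_mul_sq (b := 1 / 2) (by norm_num)).congr (ae_of_all _ fun t => ?_)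
  simp only
  congr 2
  ring

/-- Near `0` the integrand is dominated by `|log t|`, and beyond `1` by `t exp(-t²/2)`. -/
theorem integrableOn_logGaussianIntegrand : IntegrableOn logGaussianIntegrand (Ioi 0) := by
  have hmeas : Measurable logGaussianIntegrand := by
    unfold logGaussianIntegrand
    fun_prop
  rw [← Ioc_union_Ioi_eq_Ioi zero_le_one]
  refine IntegrableOn.union ?_ ?_
  · have hlog : IntegrableOn Real.log (Ioc 0 1) :=
      (intervalIntegrable_iff_integrableOn_Ioc_of_le zero_le_one).1
        intervalIntegral.intervalIntegrable_log'
    refine Integrable.mono hlog hmeas.aestronglyMeasurable (ae_of_all _ fun t => ?_)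
    rw [logGaussianIntegrand, norm_mul]
    refine mul_le_of_le_one_right (norm_nonneg _) ?_
    rw [Real.norm_of_nonneg (Real.exp_pos _).le, Real.exp_le_one_iff]
    nlinarith [sq_nonneg t]
  · refine Integrable.mono integrable_mul_exp_neg_sq_div_two.integrableOn hmeas.aestronglyMeasurable ?_
    filter_upwards [ae_restrict_mem measurableSet_Ioi] with t ht
    have ht1 : (1 : ℝ) < t := ht
    rw [logGaussianIntegrand, norm_mul, norm_mul]
    refine mul_le_mul_of_nonneg_right ?_ (norm_nonneg _)
    rw [Real.norm_of_nonneg (Real.log_nonneg ht1.le), Real.norm_of_nonneg (by linarith)]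
    linarith [Real.log_le_sub_one_of_pos (by linarith : 0 < t)]

theorem integral_logGaussianIntegrand :
    ∫ t in Ioi 0, logGaussianIntegrand t =
      -(√(2 * Real.pi) / 4) * (Real.eulerMascheroniConstant + Real.log 2) := by
  -- The substitution `s = x²/2` is made as a scaling followed by a squaring; it turns the integral
  -- of `g` into the Gaussian one.
  set g : ℝ → ℝ := fun t => t ^ (-(1 / 2) : ℝ) * (Real.log t * Real.exp (-t)) with hg
  have h1 : ∫ t in Ioi (0 : ℝ), (1 / 2 : ℝ) • g (1 / 2 * t) = ∫ t in Ioi 0, g t := by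
    have := integral_comp_mul_left_Ioi' g 0 (b := 1 / 2) (by norm_num)
    rw [mul_zero] at this
    rw [integral_smul, this]
  have h2 := integral_comp_rpow_Ioi_of_pos (g := fun t => (1 / 2 : ℝ) • g (1 / 2 * t)) (p := 2)
    (by norm_num)
  have h3 : ∫ x in Ioi (0 : ℝ), (2 * x ^ (2 - 1 : ℝ)) • (1 / 2 : ℝ) • g (1 / 2 * x ^ (2 : ℝ)) =
      ∫ x in Ioi (0 : ℝ), (2 * √2 * logGaussianIntegrand x -
        √2 * Real.log 2 * Real.exp (-x ^ 2 / 2)) := by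
    refine setIntegral_congr_fun measurableSet_Ioi fun x hx => ?_
    have hx : 0 < x := hx
    have hs : (1 / 2 * x ^ 2) ^ (-(1 / 2) : ℝ) = √2 / x := by
      rw [Real.rpow_neg (by positivity), ← Real.sqrt_eq_rpow, Real.sqrt_mul (by norm_num),
        Real.sqrt_sq hx.le, one_div, Real.sqrt_inv]
      field_simp
    have hl : Real.log (1 / 2 * x ^ 2) = 2 * Real.log x - Real.log 2 := by
      rw [Real.log_mul (by norm_num) (by positivity), Real.log_pow, one_div, Real.log_inv]
      push_cast; ring
    simp only [hg, smul_eq_mul, Real.rpow_two, logGaussianIntegrand]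
    rw [hs, hl, show -(1 / 2 * x ^ 2) = -x ^ 2 / 2 by ring]
    norm_num
    field_simp
  rw [h3, h1, integral_rpow_neg_half_mul_log_mul_exp_neg, integral_sub
    (integrableOn_logGaussianIntegrand.const_mul _)
    (integrable_exp_neg_sq_div_two.integrableOn.const_mul _), integral_const_mul,
    integral_const_mul, integral_exp_neg_sq_div_two] at h2
  rw [Real.sqrt_mul (by norm_num)] at h2 ⊢
  have h22 : √2 * √2 = (2 : ℝ) := Real.mul_self_sqrt (by norm_num)
  have hs2 : √2 ≠ (0 : ℝ) := by positivity
  refine mul_left_cancel₀ hs2 ?_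
  linear_combination h2 / 2 + (√Real.pi * Real.log 2 / 4 -
    √Real.pi * (-(Real.eulerMascheroniConstant + Real.log 2) / 4)) * h22

theorem log_permConstant :
    Real.log permConstant = -(Real.eulerMascheroniConstant + Real.log 2) := by
  rw [permConstant, Real.log_exp, integral_logGaussianIntegrand]
  have : √(2 * Real.pi) ≠ 0 := by positivity
  field_simp

theorem permConstant_pos : 0 < permConstant := Real.exp_pos _

theorem permConstant_eq : permConstant = Real.exp (-Real.eulerMascheroniConstant) / 2 := by
  rw [← Real.exp_log permConstant_pos, log_permConstant, neg_add, Real.exp_add,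
    Real.exp_neg (Real.log 2),
    Real.exp_log (by norm_num)]
  ring

theorem abs_permConstant_sub_lt : |permConstant - 0.2807297419| < 1 / 10 ^ 9 := by
  have h := exp_neg_eulerMascheroniConstant_bounds
  rw [permConstant_eq, abs_lt]
  constructor <;> norm_num at h ⊢ <;> linarith [h.1, h.2]

end LogGaussianIntegral

/-! ### Moments of the logarithm of a squared standard Gaussian. -/

section GaussianLogMoments

open Set Filter Topology

theorem integrable_comp_abs_of_integrableOn_Ioi {f : ℝ → ℝ} (hf : IntegrableOn f (Ioi 0)) :
    Integrable fun x => f |x| := by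
  have hpos : IntegrableOn (fun x => f |x|) (Ioi 0) :=
    hf.congr_fun (fun x hx => by rw [abs_of_pos (show (0 : ℝ) < x from hx)]) measurableSet_Ioi
  have hneg : IntegrableOn (fun x => f |x|) (Iic 0) := by
    rw [← Measure.map_neg_eq_self (volume : Measure ℝ)]
    let m : MeasurableEmbedding fun x : ℝ => -x := (Homeomorph.neg ℝ).measurableEmbedding
    rw [m.integrableOn_map_iff]
    simp_rw [Function.comp_def, abs_neg, neg_preimage, neg_Iic, neg_zero]
    exact Iff.mpr integrableOn_Ici_iff_integrableOn_Ioi hpos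
  rw [← integrableOn_univ, ← Iic_union_Ioi (a := (0 : ℝ))]
  exact hneg.union hpos

theorem gaussianPDFReal_zero_one (x : ℝ) :
    gaussianPDFReal 0 1 x = (√(2 * Real.pi))⁻¹ * Real.exp (-x ^ 2 / 2) := by
  simp [gaussianPDFReal]

theorem integrable_comp_abs_gaussianReal {f : ℝ → ℝ}
    (hf : IntegrableOn (fun t => f t * Real.exp (-t ^ 2 / 2)) (Ioi 0)) :
    Integrable (fun y => f |y|) (gaussianReal 0 1) := by
  rw [gaussianReal_of_var_ne_zero _ one_ne_zero,
    integrable_withDensity_iff_integrable_smul' (measurable_gaussianPDF 0 1)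
      (ae_of_all _ fun _ => gaussianPDF_lt_top)]
  refine ((integrable_comp_abs_of_integrableOn_Ioi hf).const_mul (√(2 * Real.pi))⁻¹).congr
    (ae_of_all _ fun y => ?_)
  simp only [toReal_gaussianPDF, gaussianPDFReal_zero_one, smul_eq_mul, sq_abs]
  ring

theorem integral_comp_abs_gaussianReal (f : ℝ → ℝ) :
    ∫ y, f |y| ∂(gaussianReal 0 1) =
      2 / √(2 * Real.pi) * ∫ t in Ioi 0, f t * Real.exp (-t ^ 2 / 2) := by
  rw [integral_gaussianReal_eq_integral_smul one_ne_zero]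
  have h := integral_comp_abs (f := fun t => f t * Real.exp (-t ^ 2 / 2))
  simp only [gaussianPDFReal_zero_one, smul_eq_mul, sq_abs, mul_assoc] at h ⊢
  rw [integral_const_mul, div_mul_eq_mul_div, ← h]
  simp only [mul_comm (Real.exp _)]
  ring

/-- The deviation of `log (y ^ 2)` from its Gaussian mean. -/
noncomputable def logSqDeviation (y : ℝ) : ℝ := 2 * Real.log y - Real.log permConstant

theorem measurable_logSqDeviation : Measurable logSqDeviation := by
  unfold logSqDeviation; fun_prop

theorem logSqDeviation_abs (y : ℝ) : logSqDeviation |y| = logSqDeviation y := by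
  simp [logSqDeviation, Real.log_abs]

theorem logSqDeviation_eq (y : ℝ) :
    logSqDeviation y = Real.log (y ^ 2) - Real.log permConstant := by
  rw [logSqDeviation, Real.log_pow]; norm_num

theorem integrable_log_gaussianReal : Integrable Real.log (gaussianReal 0 1) := by
  simpa only [Real.log_abs] using
    integrable_comp_abs_gaussianReal (f := Real.log) integrableOn_logGaussianIntegrand

/-- The origin of `c₀`: the factor `4/√(2π)` combines the density, the two half-lines and the
exponent in `log y²`. -/
theorem integral_two_mul_log_gaussianReal :
    ∫ y, 2 * Real.log y ∂(gaussianReal 0 1) = Real.log permConstant := by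
  have h := integral_comp_abs_gaussianReal fun t => 2 * Real.log t
  simp only [Real.log_abs, mul_assoc] at h
  rw [h, integral_const_mul, permConstant, Real.log_exp]
  simp only [logGaussianIntegrand]
  ring

theorem integrable_logSqDeviation : Integrable logSqDeviation (gaussianReal 0 1) :=
  (integrable_log_gaussianReal.const_mul 2).sub (integrable_const _)

theorem integral_logSqDeviation : ∫ y, logSqDeviation y ∂(gaussianReal 0 1) = 0 := by
  simp only [logSqDeviation]
  rw [integral_sub (integrable_log_gaussianReal.const_mul 2) (integrable_const _),
    integral_two_mul_log_gaussianReal]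
  simp

theorem logSqDeviation_sqrt_permConstant : logSqDeviation √permConstant = 0 := by
  rw [logSqDeviation, Real.log_sqrt permConstant_pos.le]; ring

theorem logSqDeviation_nonpos {t : ℝ} (ht : 0 < t) (h : t ≤ √permConstant) :
    logSqDeviation t ≤ 0 := by
  rw [← logSqDeviation_sqrt_permConstant, logSqDeviation, logSqDeviation]
  linarith [Real.log_le_log ht h]

theorem logSqDeviation_nonneg {t : ℝ} (h : √permConstant ≤ t) : 0 ≤ logSqDeviation t := by
  rw [← logSqDeviation_sqrt_permConstant, logSqDeviation, logSqDeviation]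
  linarith [Real.log_le_log (Real.sqrt_pos.2 permConstant_pos) h]

theorem hasDerivAt_mul_logSqDeviation_sq {t : ℝ} (ht : 0 < t) :
    HasDerivAt (fun t => t * (logSqDeviation t ^ 2 - 4 * logSqDeviation t + 8))
      (logSqDeviation t ^ 2) t := by
  have hd : HasDerivAt logSqDeviation (2 * t⁻¹) t :=
    ((Real.hasDerivAt_log ht.ne').const_mul 2).sub_const _
  have h := (hasDerivAt_id t).mul (((hd.pow 2).sub (hd.const_mul 4)).add_const 8)
  convert! h using 1
  simp only [id]
  field_simp
  simp
  ring

theorem continuousOn_mul_logSqDeviation_sq :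
    ContinuousOn (fun t => t * (logSqDeviation t ^ 2 - 4 * logSqDeviation t + 8)) (Ici 0) := by
  -- Writing `4t log² t` as `16(√t log √t)²` reduces continuity at `0` to that of `x log x`.
  have h1 : Continuous fun t : ℝ => 16 * (√t * Real.log √t) ^ 2 :=
    ((Real.continuous_mul_log.comp Real.continuous_sqrt).pow 2).const_mul 16
  have h2 : Continuous fun t : ℝ => (4 * Real.log permConstant + 8) * (t * Real.log t) :=
    Real.continuous_mul_log.const_mul _
  have h3 : Continuous fun t : ℝ =>
      (Real.log permConstant ^ 2 + 4 * Real.log permConstant + 8) * t := by fun_prop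
  refine ((h1.sub h2).add h3).continuousOn.congr fun t ht => ?_
  have ht : 0 ≤ t := ht
  simp only [logSqDeviation, Pi.add_apply, Pi.sub_apply]
  rw [Real.log_sqrt ht, mul_pow, Real.sq_sqrt ht]
  ring

theorem integrableOn_logSqDeviation_sq :
    IntegrableOn (fun t => logSqDeviation t ^ 2) (Ioc 0 √permConstant) :=
  intervalIntegral.integrableOn_deriv_of_nonneg
    (continuousOn_mul_logSqDeviation_sq.mono Icc_subset_Ici_self)
    (fun _ ht => hasDerivAt_mul_logSqDeviation_sq ht.1) fun _ _ => sq_nonneg _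

theorem integral_logSqDeviation_sq :
    ∫ t in Ioc 0 √permConstant, logSqDeviation t ^ 2 = 8 * √permConstant := by
  have hpos := Real.sqrt_nonneg permConstant
  rw [← intervalIntegral.integral_of_le hpos,
    intervalIntegral.integral_eq_sub_of_hasDerivAt_of_le hpos
      (continuousOn_mul_logSqDeviation_sq.mono Icc_subset_Ici_self)
      (fun _ ht => hasDerivAt_mul_logSqDeviation_sq ht.1)
      ((intervalIntegrable_iff_integrableOn_Ioc_of_le hpos).2 integrableOn_logSqDeviation_sq),
    logSqDeviation_sqrt_permConstant]
  ring

/-- The negative part lives on `(0, √c₀]`; bounding the exponential by 1 there leaves an integrand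
with an elementary antiderivative. -/
theorem min_logSqDeviation_sq_mul_exp_le {t : ℝ} (ht : 0 < t) :
    min (logSqDeviation t) 0 ^ 2 * Real.exp (-t ^ 2 / 2) ≤
      (Ioc 0 √permConstant).indicator (fun t => logSqDeviation t ^ 2) t := by
  rcases le_or_gt t √permConstant with h | h
  · rw [indicator_of_mem (show t ∈ Ioc 0 √permConstant from ⟨ht, h⟩),
      min_eq_left (logSqDeviation_nonpos ht h)]
    refine mul_le_of_le_one_right (sq_nonneg _) (Real.exp_le_one_iff.2 ?_)
    nlinarith [sq_nonneg t]
  · rw [indicator_of_notMem (fun h' => h.not_ge h'.2), min_eq_right (logSqDeviation_nonneg h.le)]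
    simp

theorem integrable_indicator_logSqDeviation_sq :
    Integrable ((Ioc 0 √permConstant).indicator fun t => logSqDeviation t ^ 2) :=
  integrableOn_logSqDeviation_sq.integrable_indicator measurableSet_Ioc

theorem integrableOn_min_logSqDeviation_sq :
    IntegrableOn (fun t => min (logSqDeviation t) 0 ^ 2 * Real.exp (-t ^ 2 / 2)) (Ioi 0) := by
  refine Integrable.mono' integrable_indicator_logSqDeviation_sq.integrableOn ?_ ?_
  · have := measurable_logSqDeviation
    exact Measurable.aestronglyMeasurable (by fun_prop)
  · filter_upwards [ae_restrict_mem measurableSet_Ioi] with t ht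
    rw [Real.norm_of_nonneg (by positivity)]
    exact min_logSqDeviation_sq_mul_exp_le ht

theorem integrable_min_logSqDeviation_sq :
    Integrable (fun y => min (logSqDeviation y) 0 ^ 2) (gaussianReal 0 1) := by
  simpa only [logSqDeviation_abs] using
    integrable_comp_abs_gaussianReal (f := fun y => min (logSqDeviation y) 0 ^ 2)
      integrableOn_min_logSqDeviation_sq

theorem integral_min_logSqDeviation_sq_le :
    ∫ y, min (logSqDeviation y) 0 ^ 2 ∂(gaussianReal 0 1) ≤
      16 * √permConstant / √(2 * Real.pi) := by
  have h := integral_comp_abs_gaussianReal fun y => min (logSqDeviation y) 0 ^ 2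
  simp only [logSqDeviation_abs] at h
  have hle : ∫ t in Ioi 0, min (logSqDeviation t) 0 ^ 2 * Real.exp (-t ^ 2 / 2) ≤
      8 * √permConstant := by
    rw [← integral_logSqDeviation_sq, ← integral_indicator measurableSet_Ioc]
    refine (setIntegral_mono_on integrableOn_min_logSqDeviation_sq
      integrable_indicator_logSqDeviation_sq.integrableOn measurableSet_Ioi
      fun t ht => min_logSqDeviation_sq_mul_exp_le ht).trans ?_
    exact setIntegral_le_integral integrable_indicator_logSqDeviation_sq
      (ae_of_all _ fun t => indicator_nonneg (fun _ _ => sq_nonneg _) t)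
  rw [h]
  refine (mul_le_mul_of_nonneg_left hle (by positivity)).trans_eq ?_
  ring

theorem integrable_sq_gaussianReal : Integrable (fun y : ℝ => y ^ 2) (gaussianReal 0 1) :=
  (memLp_id_gaussianReal 2).integrable_sq

theorem integral_sq_gaussianReal : ∫ y : ℝ, y ^ 2 ∂(gaussianReal 0 1) = 1 := by
  have h := variance_id_gaussianReal (μ := 0) (v := 1)
  rw [variance_of_integral_eq_zero aemeasurable_id (by simp)] at h
  simpa using h

/-- The source of the constant 8 in the tail bound: the two terms are about 3.38 and 3.56. -/
theorem sqDeviation_moment_bound :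
    16 * √permConstant / √(2 * Real.pi) + 1 / permConstant ≤ 8 := by
  have hc := abs_lt.1 abs_permConstant_sub_lt
  norm_num at hc
  have h1 : √permConstant ≤ 0.54 := Real.sqrt_le_iff.2 ⟨by norm_num, by norm_num; linarith [hc.2]⟩
  have h2 : (2.5 : ℝ) ≤ √(2 * Real.pi) :=
    Real.le_sqrt_of_sq_le (by nlinarith [Real.pi_gt_d2])
  have h3 : 1 / permConstant ≤ 1 / 0.28 :=
    one_div_le_one_div_of_le (by norm_num) (by norm_num; linarith [hc.1])
  have h4 : 16 * √permConstant / √(2 * Real.pi) ≤ 16 * 0.54 / 2.5 := by gcongr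
  norm_num at h3 h4 ⊢
  linarith

/-- The one-coordinate majorant whose convex combinations bound squared logarithmic shortfalls. -/
noncomputable def deviationMajorant (a y : ℝ) : ℝ :=
  a ^ 2 - 2 * a * logSqDeviation y + min (logSqDeviation y) 0 ^ 2 + y ^ 2 / permConstant

theorem integrable_deviationMajorant (a : ℝ) :
    Integrable (deviationMajorant a) (gaussianReal 0 1) :=
  (((integrable_const _).sub (integrable_logSqDeviation.const_mul _)).add
    integrable_min_logSqDeviation_sq).add (integrable_sq_gaussianReal.div_const _)

theorem integral_deviationMajorant_le (a : ℝ) :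
    ∫ y, deviationMajorant a y ∂(gaussianReal 0 1) ≤ a ^ 2 + 8 := by
  have hi : Integrable (fun y => a ^ 2 - 2 * a * logSqDeviation y) (gaussianReal 0 1) :=
    (integrable_const _).sub (integrable_logSqDeviation.const_mul _)
  have hi' : Integrable (fun y => a ^ 2 - 2 * a * logSqDeviation y + min (logSqDeviation y) 0 ^ 2)
      (gaussianReal 0 1) := hi.add integrable_min_logSqDeviation_sq
  have h : ∫ y, deviationMajorant a y ∂(gaussianReal 0 1) =
      a ^ 2 + ∫ y, min (logSqDeviation y) 0 ^ 2 ∂(gaussianReal 0 1) + 1 / permConstant := by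
    simp only [deviationMajorant]
    rw [integral_add hi' (integrable_sq_gaussianReal.div_const _),
      integral_add hi integrable_min_logSqDeviation_sq,
      integral_sub (integrable_const _) (integrable_logSqDeviation.const_mul _),
      integral_const_mul, integral_logSqDeviation, integral_div, integral_sq_gaussianReal]
    simp
  rw [h]
  linarith [integral_min_logSqDeviation_sq_le, sqDeviation_moment_bound]

end GaussianLogMoments

/-! ### One Gaussian vector: sums of squares of linear forms. -/

section LinearForms

open Set Filter Topology

variable {κ K : Type*} [Fintype κ]

/-- The law of a vector of independent standard Gaussian variables. -/
noncomputable abbrev stdGaussianPi (κ : Type*) [Fintype κ] : Measure (κ → ℝ) :=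
  Measure.pi fun _ : κ => gaussianReal 0 1

theorem measurable_linearMap (l : (κ → ℝ) →ₗ[ℝ] ℝ) : Measurable l :=
  (LinearMap.continuous_of_finiteDimensional l).measurable

variable [DecidableEq κ]

theorem linearMap_apply_eq_sum_single (l : (κ → ℝ) →ₗ[ℝ] ℝ) (x : κ → ℝ) :
    l x = ∑ i, l (Pi.single i 1) * x i := by
  rw [LinearMap.pi_apply_eq_sum_univ l x]
  refine Finset.sum_congr rfl fun i _ => ?_
  rw [smul_eq_mul, mul_comm]
  congr 2
  ext j
  simp [Pi.single_apply, eq_comm]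

/-- A linear form of a standard Gaussian vector is Gaussian. -/
theorem measurePreserving_linearMap_gaussianReal (l : (κ → ℝ) →ₗ[ℝ] ℝ) :
    MeasurePreserving l (stdGaussianPi κ)
      (gaussianReal 0 (∑ i, l (Pi.single i 1) ^ 2).toNNReal) := by
  have hl : (l : (κ → ℝ) → ℝ) = fun x => ∑ i, l (Pi.single i 1) * x i :=
    funext fun x => linearMap_apply_eq_sum_single l x
  have hev : ∀ i : κ, HasLaw (fun x : κ → ℝ => x i) (gaussianReal 0 1) (stdGaussianPi κ) :=
    fun i => (measurePreserving_eval (fun _ : κ => gaussianReal 0 1) i).hasLaw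
  have hind : iIndepFun (fun (i : κ) (x : κ → ℝ) => x i) (stdGaussianPi κ) :=
    (iIndepFun_iff_hasLaw_pi_pi hev).2 HasLaw.id
  have hG : HasGaussianLaw (fun x : κ → ℝ => ∑ i, l (Pi.single i 1) * x i) (stdGaussianPi κ) :=
    iIndepFun.hasGaussianLaw_fun_sum (X := fun (i : κ) (x : κ → ℝ) => l (Pi.single i 1) * x i)
      (fun i => (hev i).hasGaussianLaw.fun_smul _)
      (hind.comp (fun i y => l (Pi.single i 1) * y) fun i => measurable_const_mul _)
  have hint : ∀ i : κ, Integrable (fun x : κ → ℝ => l (Pi.single i 1) * x i) (stdGaussianPi κ) :=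
    fun i => ((hev i).hasGaussianLaw.integrable).const_mul _
  have hmean : ∫ x, ∑ i, l (Pi.single i 1) * x i ∂(stdGaussianPi κ) = 0 := by
    rw [integral_finsetSum _ fun i _ => hint i]
    refine Finset.sum_eq_zero fun i _ => ?_
    rw [integral_const_mul, (hev i).integral_eq, integral_id_gaussianReal, mul_zero]
  have hvar : Var[fun x : κ → ℝ => ∑ i, l (Pi.single i 1) * x i; stdGaussianPi κ] =
      ∑ i, l (Pi.single i 1) ^ 2 := by
    have h := variance_sum_pi (μ := fun _ : κ => gaussianReal 0 1)
      (X := fun i y => l (Pi.single i 1) * y) fun i => (memLp_id_gaussianReal 2).const_mul _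
    have h' : (∑ i, fun x : κ → ℝ => l (Pi.single i 1) * x i) =
        fun x : κ → ℝ => ∑ i, l (Pi.single i 1) * x i := by
      ext x; simp
    rw [h'] at h
    rw [h]
    refine Finset.sum_congr rfl fun i _ => ?_
    rw [variance_const_mul, variance_fun_id_gaussianReal]
    simp
  refine ⟨measurable_linearMap l, ?_⟩
  conv_lhs => rw [hl]
  rw [hG.map_eq_gaussianReal, hmean, hvar]

theorem lintegral_linearMap_sq (l : (κ → ℝ) →ₗ[ℝ] ℝ) :
    ∫⁻ x, ENNReal.ofReal (l x ^ 2) ∂(stdGaussianPi κ) =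
      ENNReal.ofReal (∑ i, l (Pi.single i 1) ^ 2) := by
  set v : NNReal := (∑ i, l (Pi.single i 1) ^ 2).toNNReal with hv
  have hi : Integrable (fun y : ℝ => y ^ 2) (gaussianReal 0 v) :=
    (memLp_id_gaussianReal 2).integrable_sq
  rw [(measurePreserving_linearMap_gaussianReal l).lintegral_comp
    (f := fun y => ENNReal.ofReal (y ^ 2)) (by fun_prop),
    ← ofReal_integral_eq_lintegral_ofReal hi
      (ae_of_all _ fun y => sq_nonneg _)]
  have h := variance_id_gaussianReal (μ := 0) (v := v)
  rw [variance_of_integral_eq_zero aemeasurable_id (by simp)] at h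
  simp only [id] at h ⊢
  rw [h, hv, Real.coe_toNNReal _ (Finset.sum_nonneg fun i _ => sq_nonneg _)]

theorem lintegral_sum_linearMap_sq [Fintype K] (l : K → (κ → ℝ) →ₗ[ℝ] ℝ) :
    ∫⁻ x, ENNReal.ofReal (∑ k, l k x ^ 2) ∂(stdGaussianPi κ) =
      ENNReal.ofReal (∑ k, ∑ i, l k (Pi.single i 1) ^ 2) := by
  simp_rw [ENNReal.ofReal_sum_of_nonneg fun k (_ : k ∈ Finset.univ) => sq_nonneg (l k _)]
  rw [lintegral_finsetSum _ fun k _ => by have := measurable_linearMap (l k); fun_prop,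
    ENNReal.ofReal_sum_of_nonneg fun k _ => Finset.sum_nonneg fun i _ => sq_nonneg _]
  exact Finset.sum_congr rfl fun k _ => lintegral_linearMap_sq (l k)

theorem sq_le_exp_of_nonneg {x : ℝ} (hx : 0 ≤ x) : x ^ 2 ≤ Real.exp x := by
  have h1 : x / 2 ≤ Real.exp (x / 2 - 1) := by linarith [Real.add_one_le_exp (x / 2 - 1)]
  have h2 : (2 : ℝ) ≤ Real.exp 1 := by linarith [Real.add_one_le_exp (1 : ℝ)]
  have h3 : x ≤ Real.exp (x / 2) := by
    rw [show x / 2 = (x / 2 - 1) + 1 by ring, Real.exp_add]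
    nlinarith [Real.exp_pos (x / 2 - 1)]
  calc x ^ 2 ≤ Real.exp (x / 2) ^ 2 := by gcongr
    _ = Real.exp x := by rw [← Real.exp_nat_mul]; congr 1; push_cast; ring

/-- Expand `(A - Z)²` with `A ≥ 0`, so that `-2AZ ≤ -2AL`. The remaining `Z²` is at most `L²` when
`Z ≤ 0` and at most `exp Z` when `Z ≥ 0`. In the application `exp Z` is the quadratic form divided
by `T c₀`, so its mean is known. -/
theorem max_sub_sq_le {a Z L : ℝ} (hLZ : L ≤ Z) :
    max (a - Z) 0 ^ 2 ≤ max a 0 ^ 2 - 2 * max a 0 * L + min L 0 ^ 2 + Real.exp Z := by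
  set A := max a 0 with hA
  have hA0 : 0 ≤ A := le_max_right _ _
  have haA : a ≤ A := le_max_left _ _
  have h1 : max (a - Z) 0 ^ 2 ≤ (A - Z) ^ 2 ∨ max (a - Z) 0 = 0 := by
    rcases le_total (a - Z) 0 with h | h
    · exact Or.inr (max_eq_right h)
    · left; rw [max_eq_left h]; nlinarith
  have hAL : A * L ≤ A * Z := mul_le_mul_of_nonneg_left hLZ hA0
  have h2 : (A - Z) ^ 2 ≤ A ^ 2 - 2 * A * L + min L 0 ^ 2 + Real.exp Z := by
    rcases le_total Z 0 with h | h
    · rw [min_eq_left (hLZ.trans h)]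
      nlinarith [Real.exp_pos Z]
    · nlinarith [sq_le_exp_of_nonneg h, sq_nonneg (min L 0)]
  rcases h1 with h1 | h1
  · exact h1.trans h2
  · rw [h1]; nlinarith [sq_nonneg (A - Z)]

/-- Jensen is used twice, for the concave `log` and for the convex square. The result is linear in
the weights, so its mean needs only the law of each `y k`, not their joint law. -/
theorem max_sub_log_sq_le_sum_deviationMajorant (S : Finset K) {w y : K → ℝ}
    (hw : ∀ k ∈ S, 0 ≤ w k) (hw1 : ∑ k ∈ S, w k = 1) (hy : ∀ k ∈ S, y k ≠ 0) (a : ℝ) :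
    max (a - (Real.log (∑ k ∈ S, w k * y k ^ 2) - Real.log permConstant)) 0 ^ 2 ≤
      ∑ k ∈ S, w k * deviationMajorant (max a 0) (y k) := by
  set q := ∑ k ∈ S, w k * y k ^ 2 with hq
  set L := ∑ k ∈ S, w k * logSqDeviation (y k) with hL
  have hqpos : 0 < q := by
    obtain ⟨k, hk, hk0⟩ := Finset.exists_ne_zero_of_sum_ne_zero (hw1.trans_ne one_ne_zero)
    refine Finset.sum_pos' (fun j hj => mul_nonneg (hw j hj) (sq_nonneg _)) ⟨k, hk, ?_⟩
    have := lt_of_le_of_ne (hw k hk) hk0.symm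
    have := hy k hk
    positivity
  have hlog : L ≤ Real.log q - Real.log permConstant := by
    have h := strictConcaveOn_log_Ioi.concaveOn.le_map_sum (t := S) (w := w)
      (p := fun k => y k ^ 2) hw hw1 fun k hk => by
        have := hy k hk
        show 0 < y k ^ 2
        positivity
    simp only [smul_eq_mul] at h
    have h' : L = ∑ k ∈ S, w k * Real.log (y k ^ 2) - Real.log permConstant := by
      simp only [hL, logSqDeviation_eq, mul_sub, Finset.sum_sub_distrib]
      rw [← Finset.sum_mul, hw1, one_mul]
    linarith
  have hmin : min L 0 ^ 2 ≤ ∑ k ∈ S, w k * min (logSqDeviation (y k)) 0 ^ 2 := by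
    have h := (Even.convexOn_pow (n := 2) even_two).map_sum_le (t := S) (w := w)
      (p := fun k => min (logSqDeviation (y k)) 0) hw hw1 fun _ _ => mem_univ _
    simp only [smul_eq_mul] at h
    refine le_trans ?_ h
    have h1 : ∑ k ∈ S, w k * min (logSqDeviation (y k)) 0 ≤ min L 0 := by
      refine le_min (Finset.sum_le_sum fun k hk =>
        mul_le_mul_of_nonneg_left (min_le_left _ _) (hw k hk)) (Finset.sum_nonpos fun k hk =>
        mul_nonpos_of_nonneg_of_nonpos (hw k hk) (min_le_right _ _))
    nlinarith [min_le_right L 0]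
  have hexp : Real.exp (Real.log q - Real.log permConstant) = q / permConstant := by
    rw [Real.exp_sub, Real.exp_log hqpos, Real.exp_log permConstant_pos]
  have hsum : ∑ k ∈ S, w k * deviationMajorant (max a 0) (y k) =
      max a 0 ^ 2 - 2 * max a 0 * L + ∑ k ∈ S, w k * min (logSqDeviation (y k)) 0 ^ 2
        + q / permConstant := by
    have h1 : max a 0 ^ 2 = ∑ k ∈ S, w k * max a 0 ^ 2 := by rw [← Finset.sum_mul, hw1, one_mul]
    rw [h1, hL, hq, Finset.mul_sum, Finset.sum_div, ← Finset.sum_sub_distrib,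
      ← Finset.sum_add_distrib, ← Finset.sum_add_distrib]
    refine Finset.sum_congr rfl fun k _ => ?_
    rw [deviationMajorant]
    ring
  have h := max_sub_sq_le (a := a) hlog
  rw [hexp] at h
  rw [hsum]
  linarith

/-- The squared amount by which `log t` falls short of `b`; it is infinite when `t ≤ 0`. -/
noncomputable def logDeficitSq (b t : ℝ) : ENNReal :=
  if t ≤ 0 then ⊤ else ENNReal.ofReal (max (b - Real.log t) 0 ^ 2)

theorem measurable_logDeficitSq (b : ℝ) : Measurable (logDeficitSq b) :=
  Measurable.ite measurableSet_Iic measurable_const (by fun_prop)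

theorem logDeficitSq_of_pos (b : ℝ) {t : ℝ} (ht : 0 < t) :
    logDeficitSq b t = ENNReal.ofReal (max (b - Real.log t) 0 ^ 2) := if_neg ht.not_ge

/-- The one-row estimate. Each nonzero form, scaled to unit variance, is standard Gaussian, with
weight its share of `T`; integrating the majorant termwise kills the centred linear part. -/
theorem lintegral_logDeficitSq_sum_linearMap_sq_le [Fintype K] (l : K → (κ → ℝ) →ₗ[ℝ] ℝ) {T : ℝ}
    (hT : ∑ k, ∑ i, l k (Pi.single i 1) ^ 2 = T) (hpos : 0 < T) (b : ℝ) :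
    ∫⁻ x, logDeficitSq b (∑ k, l k x ^ 2) ∂(stdGaussianPi κ) ≤
      ENNReal.ofReal (max (b - Real.log T - Real.log permConstant) 0 ^ 2 + 8) := by
  classical
  set v : K → ℝ := fun k => ∑ i, l k (Pi.single i 1) ^ 2 with hv
  have hv0 : ∀ k, 0 ≤ v k := fun k => Finset.sum_nonneg fun i _ => sq_nonneg _
  -- Forms with zero variance cannot be normalised; they vanish identically and are dropped.
  set S : Finset K := Finset.univ.filter fun k => v k ≠ 0 with hS
  have hvS : ∀ k ∈ S, 0 < v k := fun k hk => (hv0 k).lt_of_ne (Finset.mem_filter.1 hk).2.symm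
  have hlS : ∀ k ∉ S, ∀ x, l k x = 0 := by
    intro k hk x
    have h0 : v k = 0 := by simpa [hS] using hk
    rw [linearMap_apply_eq_sum_single]
    refine Finset.sum_eq_zero fun i _ => ?_
    have := (Finset.sum_eq_zero_iff_of_nonneg fun i _ => sq_nonneg _).1 h0 i (Finset.mem_univ _)
    rw [pow_eq_zero_iff two_ne_zero] at this
    rw [this, zero_mul]
  set w : K → ℝ := fun k => v k / T with hw
  set y : K → (κ → ℝ) → ℝ := fun k x => ((√(v k))⁻¹ • l k) x with hy
  have hw0 : ∀ k ∈ S, 0 ≤ w k := fun k _ => div_nonneg (hv0 k) hpos.le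
  have hw1 : ∑ k ∈ S, w k = 1 := by
    rw [hw, ← Finset.sum_div, hS, Finset.sum_filter_ne_zero, hT, div_self hpos.ne']
  have hlaw : ∀ k ∈ S, MeasurePreserving (y k) (stdGaussianPi κ) (gaussianReal 0 1) := by
    intro k hk
    have h := measurePreserving_linearMap_gaussianReal ((√(v k))⁻¹ • l k)
    have h1 : ∑ i, ((√(v k))⁻¹ • l k) (Pi.single i 1) ^ 2 = 1 := by
      simp only [LinearMap.smul_apply, smul_eq_mul, mul_pow, inv_pow, Real.sq_sqrt (hv0 k)]
      rw [← Finset.mul_sum]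
      exact inv_mul_cancel₀ (hvS k hk).ne'
    rw [h1, Real.toNNReal_one] at h
    exact h
  have hne : ∀ᵐ x ∂(stdGaussianPi κ), ∀ k ∈ S, y k x ≠ 0 := by
    refine (Filter.eventually_all_finset S).2 ?_
    intro k hk
    have := nullSingletonClass_gaussianReal (μ := 0) (v := 1) one_ne_zero
    exact (hlaw k hk).quasiMeasurePreserving.ae (p := fun t => t ≠ 0) (Measure.ae_ne _ 0)
  have hsum : ∀ x, ∑ k, l k x ^ 2 = T * ∑ k ∈ S, w k * y k x ^ 2 := by
    intro x
    rw [← Finset.sum_subset (Finset.subset_univ S)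
      (fun k _ hk => by rw [hlS k hk x]; ring), Finset.mul_sum]
    refine Finset.sum_congr rfl fun k hk => ?_
    have := (hvS k hk).ne'
    simp only [hw, hy, LinearMap.smul_apply, smul_eq_mul, mul_pow, inv_pow, Real.sq_sqrt (hv0 k)]
    field_simp
  set A := max (b - Real.log T - Real.log permConstant) 0 with hA
  have hbound : ∀ᵐ x ∂(stdGaussianPi κ), logDeficitSq b (∑ k, l k x ^ 2) ≤
      ENNReal.ofReal (∑ k ∈ S, w k * deviationMajorant A (y k x)) ∧
      0 ≤ ∑ k ∈ S, w k * deviationMajorant A (y k x) := by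
    filter_upwards [hne] with x hx
    have h := max_sub_log_sq_le_sum_deviationMajorant S hw0 hw1 hx
      (b - Real.log T - Real.log permConstant)
    refine ⟨?_, (sq_nonneg _).trans h⟩
    have hq : 0 < ∑ k ∈ S, w k * y k x ^ 2 := by
      obtain ⟨k, hk, _⟩ := Finset.exists_ne_zero_of_sum_ne_zero (hw1.trans_ne one_ne_zero)
      refine Finset.sum_pos (fun j hj => ?_) ⟨k, hk⟩
      have := hx j hj
      exact mul_pos (div_pos (hvS j hj) hpos) (by positivity)
    rw [hsum, logDeficitSq_of_pos b (mul_pos hpos hq), Real.log_mul hpos.ne' hq.ne']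
    refine ENNReal.ofReal_le_ofReal (le_trans (le_of_eq ?_) h)
    congr 2
    ring
  have hint : ∀ k ∈ S, Integrable (fun x => w k * deviationMajorant A (y k x)) (stdGaussianPi κ) :=
    fun k hk => ((hlaw k hk).integrable_comp_of_integrable
      (integrable_deviationMajorant A)).const_mul _
  calc ∫⁻ x, logDeficitSq b (∑ k, l k x ^ 2) ∂(stdGaussianPi κ)
      ≤ ∫⁻ x, ENNReal.ofReal (∑ k ∈ S, w k * deviationMajorant A (y k x)) ∂(stdGaussianPi κ) :=
        lintegral_mono_ae (hbound.mono fun _ h => h.1)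
    _ = ENNReal.ofReal (∫ x, ∑ k ∈ S, w k * deviationMajorant A (y k x) ∂(stdGaussianPi κ)) :=
        (ofReal_integral_eq_lintegral_ofReal (integrable_finsetSum _ hint)
          (hbound.mono fun _ h => h.2)).symm
    _ ≤ ENNReal.ofReal (A ^ 2 + 8) := by
        refine ENNReal.ofReal_le_ofReal ?_
        rw [integral_finsetSum _ hint]
        calc ∑ k ∈ S, ∫ x, w k * deviationMajorant A (y k x) ∂(stdGaussianPi κ)
            ≤ ∑ k ∈ S, w k * (A ^ 2 + 8) := by
              refine Finset.sum_le_sum fun k hk => ?_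
              rw [integral_const_mul]
              refine mul_le_mul_of_nonneg_left ?_ (hw0 k hk)
              refine le_of_eq_of_le ?_ (integral_deviationMajorant_le A)
              rw [← (hlaw k hk).map_eq, integral_map (hlaw k hk).aemeasurable]
              rw [(hlaw k hk).map_eq]
              exact (integrable_deviationMajorant A).aestronglyMeasurable
          _ = A ^ 2 + 8 := by rw [← Finset.sum_mul, hw1, one_mul]

end LinearForms

/-! ### Several Gaussian vectors: induction on the number of rows. -/

section MultilinearForms

open Set Filter Topology

variable {κ J : Type*} [DecidableEq κ]

/-- The tuple of standard basis vectors selected by `s`. -/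
def basisTuple {n : ℕ} (s : Fin n → κ) : Fin n → κ → ℝ := fun i => Pi.single (s i) 1

/-- The linear form in the first argument obtained by filling the others with basis vectors. -/
def headLinearForm {n : ℕ} (g : MultilinearMap ℝ (fun _ : Fin (n + 1) => κ → ℝ) ℝ)
    (s : Fin n → κ) : (κ → ℝ) →ₗ[ℝ] ℝ where
  toFun x := g.curryLeft x (basisTuple s)
  map_add' x y := by rw [map_add]; rfl
  map_smul' c x := by rw [map_smul]; rfl

theorem headLinearForm_single {n : ℕ} (g : MultilinearMap ℝ (fun _ : Fin (n + 1) => κ → ℝ) ℝ)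
    (s : Fin n → κ) (k : κ) :
    headLinearForm g s (Pi.single k 1) = g (basisTuple (Fin.cons k s : Fin (n + 1) → κ)) := by
  change g (Fin.cons (Pi.single k 1) (basisTuple s)) = _
  congr 1
  ext i
  refine Fin.cases ?_ (fun i => ?_) i <;> simp [basisTuple]

variable [Fintype κ]

/-- The sum of the squares of the values of a finite family of multilinear forms. -/
def sumSqForms [Fintype J] {n : ℕ} (g : J → MultilinearMap ℝ (fun _ : Fin n => κ → ℝ) ℝ)
    (x : Fin n → κ → ℝ) : ℝ := ∑ j, g j x ^ 2

/-- The sum of the squares of all coefficients of a finite family of multilinear forms. -/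
def sumSqCoeffs [Fintype J] {n : ℕ} (g : J → MultilinearMap ℝ (fun _ : Fin n => κ → ℝ) ℝ) : ℝ :=
  ∑ j, ∑ s : Fin n → κ, g j (basisTuple s) ^ 2

theorem multilinearMap_apply_eq_sum {n : ℕ} (g : MultilinearMap ℝ (fun _ : Fin n => κ → ℝ) ℝ)
    (x : Fin n → κ → ℝ) : g x = ∑ s : Fin n → κ, (∏ i, x i (s i)) * g (basisTuple s) := by
  have hx : x = fun i => ∑ k, x i k • (Pi.single k 1 : κ → ℝ) := by
    ext i k
    simp [Finset.sum_apply, Pi.single_apply]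
  conv_lhs => rw [hx]
  rw [g.map_sum]
  exact Finset.sum_congr rfl fun s _ => g.map_smul_univ _ _

theorem measurable_multilinearMap {n : ℕ} (g : MultilinearMap ℝ (fun _ : Fin n => κ → ℝ) ℝ) :
    Measurable g := by
  have h : (g : (Fin n → κ → ℝ) → ℝ) =
      fun x => ∑ s : Fin n → κ, (∏ i, x i (s i)) * g (basisTuple s) :=
    funext (multilinearMap_apply_eq_sum g)
  rw [h]
  fun_prop

variable [Fintype J]

theorem measurable_sumSqForms {n : ℕ} (g : J → MultilinearMap ℝ (fun _ : Fin n => κ → ℝ) ℝ) :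
    Measurable (sumSqForms g) := by
  have := fun j => measurable_multilinearMap (g j)
  unfold sumSqForms
  fun_prop

/-- Fixing the first argument makes every remaining coefficient a linear form in it, so the one-row
estimate applies to a family indexed by `J × (Fin n → κ)`. -/
theorem sumSqCoeffs_curryLeft {n : ℕ}
    (g : J → MultilinearMap ℝ (fun _ : Fin (n + 1) => κ → ℝ) ℝ) (x : κ → ℝ) :
    sumSqCoeffs (fun j => (g j).curryLeft x) =
      ∑ p : J × (Fin n → κ), headLinearForm (g p.1) p.2 x ^ 2 := by
  rw [Fintype.sum_prod_type]
  rfl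

theorem sumSqCoeffs_succ {n : ℕ} (g : J → MultilinearMap ℝ (fun _ : Fin (n + 1) => κ → ℝ) ℝ) :
    ∑ p : J × (Fin n → κ), ∑ k, headLinearForm (g p.1) p.2 (Pi.single k 1) ^ 2 = sumSqCoeffs g := by
  rw [Fintype.sum_prod_type]
  refine Finset.sum_congr rfl fun j _ => ?_
  rw [Finset.sum_comm, ← Fintype.sum_prod_type']
  refine Fintype.sum_equiv (Fin.consEquiv fun _ : Fin (n + 1) => κ) _ _ fun p => ?_
  simp only [headLinearForm_single]
  rfl

theorem sumSqForms_zero (g : J → MultilinearMap ℝ (fun _ : Fin 0 => κ → ℝ) ℝ)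
    (x : Fin 0 → κ → ℝ) : sumSqForms g x = sumSqCoeffs g := by
  refine Finset.sum_congr rfl fun j _ => ?_
  rw [Fintype.sum_unique, Subsingleton.elim x (basisTuple default)]

theorem lintegral_pi_succ {E : Type*} [MeasurableSpace E] (μ : Measure E) [SigmaFinite μ] {n : ℕ}
    {F : (Fin (n + 1) → E) → ENNReal} (hF : Measurable F) :
    ∫⁻ x, F x ∂(Measure.pi fun _ => μ) =
      ∫⁻ x, ∫⁻ y, F (Fin.cons x y) ∂(Measure.pi fun _ => μ) ∂μ := by
  have h := (measurePreserving_piFinSuccAbove (fun _ : Fin (n + 1) => μ) 0).symm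
  rw [← h.map_eq, lintegral_map_equiv, lintegral_prod]
  · refine lintegral_congr fun x => lintegral_congr fun y => ?_
    congr 1
    exact Fin.insertNth_zero' x y
  · exact (hF.comp h.measurable).aemeasurable

theorem lintegral_sumSqForms {n : ℕ} (g : J → MultilinearMap ℝ (fun _ : Fin n => κ → ℝ) ℝ) :
    ∫⁻ x, ENNReal.ofReal (sumSqForms g x) ∂(Measure.pi fun _ => stdGaussianPi κ) =
      ENNReal.ofReal (sumSqCoeffs g) := by
  induction n with
  | zero => simp [sumSqForms_zero]
  | succ n ih =>
    rw [lintegral_pi_succ _ (measurable_sumSqForms g).ennreal_ofReal]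
    have h : ∀ x, ∫⁻ y, ENNReal.ofReal (sumSqForms g (Fin.cons x y))
        ∂(Measure.pi fun _ => stdGaussianPi κ) =
        ENNReal.ofReal (sumSqCoeffs fun j => (g j).curryLeft x) := fun x =>
      ih fun j => (g j).curryLeft x
    simp_rw [h, sumSqCoeffs_curryLeft]
    rw [lintegral_sum_linearMap_sq, sumSqCoeffs_succ]

/-- The bound given by the inductive hypothesis for the inner integral is again a squared log
deficit, at the threshold lowered by `n log c₀`, plus a constant. The one-row estimate then
integrates it over the first row. -/
theorem lintegral_logDeficitSq_sumSqForms_le {n : ℕ}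
    (g : J → MultilinearMap ℝ (fun _ : Fin n => κ → ℝ) ℝ) (hg : 0 < sumSqCoeffs g) (b : ℝ) :
    ∫⁻ x, logDeficitSq b (sumSqForms g x) ∂(Measure.pi fun _ => stdGaussianPi κ) ≤
      ENNReal.ofReal (max (b - Real.log (sumSqCoeffs g) - n * Real.log permConstant) 0 ^ 2
        + 8 * n) := by
  induction n generalizing b with
  | zero => simp [sumSqForms_zero, logDeficitSq_of_pos b hg]
  | succ n ih =>
    rw [lintegral_pi_succ _ (F := fun x => logDeficitSq b (sumSqForms g x))
      ((measurable_logDeficitSq b).comp (measurable_sumSqForms g))]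
    have hinner : ∀ x, ∫⁻ y, logDeficitSq b (sumSqForms g (Fin.cons x y))
        ∂(Measure.pi fun _ => stdGaussianPi κ) ≤
        logDeficitSq (b - n * Real.log permConstant)
          (∑ p : J × (Fin n → κ), headLinearForm (g p.1) p.2 x ^ 2) + ENNReal.ofReal (8 * n) := by
      intro x
      rw [← sumSqCoeffs_curryLeft]
      -- If all remaining coefficients vanish, the inductive hypothesis is unavailable, but the
      -- right side is `⊤`.
      rcases le_or_gt (sumSqCoeffs fun j => (g j).curryLeft x) 0 with h0 | h0
      · rw [logDeficitSq, if_pos h0, top_add]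
        exact le_top
      · rw [logDeficitSq_of_pos _ h0, ← ENNReal.ofReal_add (sq_nonneg _) (by positivity)]
        refine (ih (fun j => (g j).curryLeft x) h0 b).trans_eq ?_
        congr 4
        ring
    refine (lintegral_mono hinner).trans ?_
    rw [lintegral_add_right _ measurable_const, lintegral_const, measure_univ, mul_one]
    refine (add_le_add_left (lintegral_logDeficitSq_sum_linearMap_sq_le _
      (sumSqCoeffs_succ g) hg _) _).trans_eq ?_
    rw [← ENNReal.ofReal_add (by positivity) (by positivity)]
    push_cast
    rw [show b - n * Real.log permConstant - Real.log (sumSqCoeffs g) - Real.log permConstant =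
      b - Real.log (sumSqCoeffs g) - (n + 1) * Real.log permConstant by ring]
    congr 1
    ring

end MultilinearForms

/-! ### The determinant as a multilinear form, and the permanent as its sum of squared coefficients.
-/

section DeterminantEstimator

variable {n : ℕ} (A : Matrix (Fin n) (Fin n) ℝ)

/-- The determinant of the scaled matrix as a multilinear form in the rows of `u`. -/
noncomputable def scaledDetForm : MultilinearMap ℝ (fun _ : Fin n => Fin n → ℝ) ℝ :=
  (Matrix.detRowAlternating (n := Fin n) (R := ℝ)).toMultilinearMap.compLinearMap fun i =>
    LinearMap.pi fun j => √(A i j) • LinearMap.proj j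

theorem scaledDetForm_apply (u : Fin n → Fin n → ℝ) :
    scaledDetForm A u = (gaussianScaledMatrix A u).det := by
  change Matrix.det _ = _
  congr 1
  ext i j
  simp [gaussianScaledMatrix, mul_comm]

theorem permEstimator_eq_sumSqForms (u : Fin n → Fin n → ℝ) :
    permEstimator A u = sumSqForms (fun _ : Unit => scaledDetForm A) u := by
  simp [sumSqForms, scaledDetForm_apply, permEstimator]

theorem scaledDetForm_basisTuple (s : Fin n → Fin n) :
    scaledDetForm A (basisTuple s) =
      (∏ i, √(A i (s i))) * (Matrix.of (basisTuple s) : Matrix (Fin n) (Fin n) ℝ).det := by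
  rw [scaledDetForm_apply, ← Matrix.det_mul_column]
  congr 1
  ext i j
  simp only [gaussianScaledMatrix, basisTuple, Matrix.of_apply, Pi.single_apply]
  split_ifs with h <;> simp [h]

theorem det_basisTuple_perm_sq (σ : Equiv.Perm (Fin n)) :
    (Matrix.of (basisTuple σ) : Matrix (Fin n) (Fin n) ℝ).det ^ 2 = 1 := by
  have h : (Matrix.of (basisTuple σ) : Matrix (Fin n) (Fin n) ℝ) =
      (1 : Matrix (Fin n) (Fin n) ℝ).submatrix σ id := by
    ext i j
    simp [basisTuple, Matrix.one_apply, Pi.single_apply, eq_comm]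
  rw [h, Matrix.det_permute, Matrix.det_one, mul_one]
  rcases Int.units_eq_one_or (Equiv.Perm.sign σ) with h | h <;> simp [h]

theorem det_basisTuple_of_not_injective {s : Fin n → Fin n} (hs : ¬ Function.Injective s) :
    (Matrix.of (basisTuple s) : Matrix (Fin n) (Fin n) ℝ).det = 0 := by
  simp only [Function.Injective, not_forall] at hs
  obtain ⟨i, j, hij, hne⟩ := hs
  refine Matrix.det_zero_of_row_eq hne ?_
  ext k
  simp [basisTuple, hij]

variable {A}

theorem sumSqCoeffs_scaledDetForm (hA : ∀ i j, 0 ≤ A i j) :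
    sumSqCoeffs (fun _ : Unit => scaledDetForm A) = A.permanent := by
  -- `Matrix.permanent` multiplies the entries `A (σ i) i`; transposing gives the row convention `A
  -- i (σ i)`.
  rw [← Matrix.permanent_transpose]
  simp only [sumSqCoeffs, Finset.univ_unique, Finset.sum_singleton, Matrix.permanent,
    Matrix.transpose_apply]
  refine (Finset.sum_of_injOn (fun σ : Equiv.Perm (Fin n) => (σ : Fin n → Fin n))
    DFunLike.coe_injective.injOn (fun _ _ => by simp) (fun s _ hs => ?_) fun σ _ => ?_).symm
  · rw [scaledDetForm_basisTuple, det_basisTuple_of_not_injective, mul_zero, zero_pow two_ne_zero]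
    intro hinj
    exact hs ⟨Equiv.ofBijective s (Finite.injective_iff_bijective.1 hinj), by simp, rfl⟩
  · rw [scaledDetForm_basisTuple, mul_pow, det_basisTuple_perm_sq, mul_one, ← Finset.prod_pow]
    exact Finset.prod_congr rfl fun i _ => (Real.sq_sqrt (hA _ _)).symm

end DeterminantEstimator

/-! ### Transfer to the given random variables, and the tail bounds. -/

section GaussianMatrixLaw

variable {n : ℕ} {Ω : Type*} [MeasurableSpace Ω] {P : Measure Ω}
  {u : Fin n → Fin n → Ω → ℝ}

theorem measurePreserving_uncurry_pi {ι κ E : Type*} [Fintype ι] [Fintype κ] [MeasurableSpace E]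
    (μ : Measure E) [SigmaFinite μ] :
    MeasurePreserving (MeasurableEquiv.curry ι κ E).symm
      (Measure.pi fun _ : ι => Measure.pi fun _ : κ => μ) (Measure.pi fun _ : ι × κ => μ) := by
  refine ⟨MeasurableEquiv.measurable _, (Measure.pi_eq fun s _ => ?_).symm⟩
  rw [MeasurableEquiv.map_apply, Fintype.prod_prod_type]
  have h : (MeasurableEquiv.curry ι κ E).symm ⁻¹' Set.univ.pi s =
      Set.univ.pi fun i => Set.univ.pi fun j => s (i, j) := by
    ext x
    simp [Set.mem_pi, MeasurableEquiv.coe_curry_symm, Function.uncurry]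
  rw [h, Measure.pi_pi]
  simp_rw [Measure.pi_pi]

theorem hasLaw_gaussianMatrix (hlaw : ∀ i j, HasLaw (u i j) (gaussianReal 0 1) P)
    (hindep : iIndepFun (fun (p : Fin n × Fin n) => u p.1 p.2) P) :
    HasLaw (fun ω i j => u i j ω) (Measure.pi fun _ : Fin n => stdGaussianPi (Fin n)) P := by
  have h : HasLaw (fun ω (p : Fin n × Fin n) => u p.1 p.2 ω)
      (Measure.pi fun _ => gaussianReal 0 1) P := hindep.hasLaw_pi fun p => hlaw p.1 p.2
  exact ((measurePreserving_uncurry_pi (gaussianReal 0 1)).symm _).comp_hasLaw h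

theorem measurable_permEstimator (A : Matrix (Fin n) (Fin n) ℝ) : Measurable (permEstimator A) := by
  rw [show permEstimator A = _ from funext (permEstimator_eq_sumSqForms A)]
  exact measurable_sumSqForms _

theorem permEstimator_nonneg (A : Matrix (Fin n) (Fin n) ℝ) (x : Fin n → Fin n → ℝ) :
    0 ≤ permEstimator A x := sq_nonneg _

theorem permanent_nonneg {A : Matrix (Fin n) (Fin n) ℝ} (hA : ∀ i j, 0 ≤ A i j) :
    0 ≤ A.permanent :=
  Finset.sum_nonneg fun _ _ => Finset.prod_nonneg fun _ _ => hA _ _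

theorem lintegral_permEstimator {A : Matrix (Fin n) (Fin n) ℝ} (hA : ∀ i j, 0 ≤ A i j)
    (hu : HasLaw (fun ω i j => u i j ω) (Measure.pi fun _ : Fin n => stdGaussianPi (Fin n)) P) :
    ∫⁻ ω, ENNReal.ofReal (permEstimator A (fun i j => u i j ω)) ∂P =
      ENNReal.ofReal A.permanent := by
  rw [hu.lintegral_comp (f := fun x => ENNReal.ofReal (permEstimator A x))
    (measurable_permEstimator A).ennreal_ofReal.aemeasurable]
  simp_rw [permEstimator_eq_sumSqForms]
  rw [lintegral_sumSqForms, sumSqCoeffs_scaledDetForm hA]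

theorem integrable_permEstimator {A : Matrix (Fin n) (Fin n) ℝ} (hA : ∀ i j, 0 ≤ A i j)
    (hu : HasLaw (fun ω i j => u i j ω) (Measure.pi fun _ : Fin n => stdGaussianPi (Fin n)) P) :
    Integrable (fun ω => permEstimator A (fun i j => u i j ω)) P := by
  refine ⟨((measurable_permEstimator A).comp_aemeasurable hu.aemeasurable).aestronglyMeasurable, ?_⟩
  rw [hasFiniteIntegral_iff_ofReal (ae_of_all _ fun ω => permEstimator_nonneg A _),
    lintegral_permEstimator hA hu]
  exact ENNReal.ofReal_lt_top

theorem integral_permEstimator {A : Matrix (Fin n) (Fin n) ℝ} (hA : ∀ i j, 0 ≤ A i j)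
    (hu : HasLaw (fun ω i j => u i j ω) (Measure.pi fun _ : Fin n => stdGaussianPi (Fin n)) P) :
    ∫ ω, permEstimator A (fun i j => u i j ω) ∂P = A.permanent := by
  rw [integral_eq_lintegral_of_nonneg_ae (ae_of_all _ fun ω => permEstimator_nonneg A _)
    (integrable_permEstimator hA hu).aestronglyMeasurable, lintegral_permEstimator hA hu,
    ENNReal.toReal_ofReal (permanent_nonneg hA)]

theorem lintegral_logDeficitSq_permEstimator_le {A : Matrix (Fin n) (Fin n) ℝ}
    (hA : ∀ i j, 0 ≤ A i j) (hper : 0 < A.permanent)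
    (hu : HasLaw (fun ω i j => u i j ω) (Measure.pi fun _ : Fin n => stdGaussianPi (Fin n)) P)
    (b : ℝ) :
    ∫⁻ ω, logDeficitSq b (permEstimator A (fun i j => u i j ω)) ∂P ≤
      ENNReal.ofReal (max (b - Real.log A.permanent - n * Real.log permConstant) 0 ^ 2
        + 8 * n) := by
  rw [hu.lintegral_comp (f := fun x => logDeficitSq b (permEstimator A x))
    ((measurable_logDeficitSq b).comp (measurable_permEstimator A)).aemeasurable]
  simp_rw [permEstimator_eq_sumSqForms]
  rw [← sumSqCoeffs_scaledDetForm hA] at hper ⊢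
  exact lintegral_logDeficitSq_sumSqForms_le _ hper b

theorem measureReal_le_permEstimator_le {A : Matrix (Fin n) (Fin n) ℝ}
    (hA : ∀ i j, 0 ≤ A i j) (hper : 0 < A.permanent)
    (hu : HasLaw (fun ω i j => u i j ω) (Measure.pi fun _ : Fin n => stdGaussianPi (Fin n)) P)
    {C : ℝ} (hC : 0 < C) :
    P.real {ω | C * A.permanent ≤ permEstimator A (fun i j => u i j ω)} ≤ C⁻¹ := by
  have h := mul_meas_ge_le_integral_of_nonneg (ae_of_all P fun ω => permEstimator_nonneg A _)
    (integrable_permEstimator hA hu) (C * A.permanent)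
  rw [integral_permEstimator hA hu] at h
  rw [inv_eq_one_div, le_div_iff₀ hC]
  refine le_of_mul_le_mul_right ?_ hper
  linarith

theorem measureReal_permEstimator_le_le (hn : 1 ≤ n) {A : Matrix (Fin n) (Fin n) ℝ}
    (hA : ∀ i j, 0 ≤ A i j) (hper : 0 < A.permanent)
    (hu : HasLaw (fun ω i j => u i j ω) (Measure.pi fun _ : Fin n => stdGaussianPi (Fin n)) P)
    {ε : ℝ} (hε : 0 < ε) (hε1 : ε < 1) :
    P.real {ω | permEstimator A (fun i j => u i j ω) ≤ (ε * permConstant) ^ n * A.permanent}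
      ≤ 8 / (n * Real.log ε ^ 2) := by
  have hn0 : (0 : ℝ) < n := by exact_mod_cast hn
  have hlogε : Real.log ε < 0 := Real.log_neg hε hε1
  -- This threshold makes the positive part in the inductive bound vanish, leaving `8n`.
  set b := Real.log A.permanent + n * Real.log permConstant with hb
  set c : ℝ := (n * Real.log ε) ^ 2 with hc
  have hc0 : 0 < c := sq_pos_of_ne_zero (mul_ne_zero hn0.ne' hlogε.ne)
  have hsub : {ω | permEstimator A (fun i j => u i j ω) ≤ (ε * permConstant) ^ n * A.permanent} ⊆
      {ω | ENNReal.ofReal c ≤ logDeficitSq b (permEstimator A (fun i j => u i j ω))} := by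
    intro ω hω
    simp only [Set.mem_ofPred_eq] at hω ⊢
    -- A vanishing estimator belongs to the event; the value `⊤` of the deficit covers it.
    rcases le_or_gt (permEstimator A (fun i j => u i j ω)) 0 with h0 | h0
    · rw [logDeficitSq, if_pos h0]
      exact le_top
    · rw [logDeficitSq_of_pos b h0]
      refine ENNReal.ofReal_le_ofReal ?_
      have hl := Real.log_le_log h0 hω
      rw [Real.log_mul (pow_pos (mul_pos hε permConstant_pos) n).ne' hper.ne', Real.log_pow,
        Real.log_mul hε.ne' permConstant_pos.ne'] at hl
      have h1 : -(n * Real.log ε) ≤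
          max (b - Real.log (permEstimator A (fun i j => u i j ω))) 0 :=
        le_max_of_le_left (by rw [hb]; linarith)
      have h2 : n * Real.log ε < 0 := mul_neg_of_pos_of_neg hn0 hlogε
      rw [hc, ← neg_sq]
      exact pow_le_pow_left₀ (by linarith) h1 2
  have hmarkov := meas_ge_le_lintegral_div (μ := P)
    (f := fun ω => logDeficitSq b (permEstimator A (fun i j => u i j ω)))
    ((measurable_logDeficitSq b).comp (measurable_permEstimator A)
      |>.comp_aemeasurable hu.aemeasurable) (ENNReal.ofReal_pos.2 hc0).ne' ENNReal.ofReal_ne_top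
  have hint := lintegral_logDeficitSq_permEstimator_le hA hper hu b
  rw [show b - Real.log A.permanent - n * Real.log permConstant = 0 by rw [hb]; ring, max_self,
    zero_pow two_ne_zero, zero_add] at hint
  have hP : P {ω | permEstimator A (fun i j => u i j ω) ≤ (ε * permConstant) ^ n * A.permanent} ≤
      ENNReal.ofReal (8 * n / c) := by
    rw [ENNReal.ofReal_div_of_pos hc0]
    exact (measure_mono hsub).trans (hmarkov.trans (ENNReal.div_le_div_right hint _))
  refine (ENNReal.toReal_le_of_le_ofReal (by positivity) hP).trans_eq ?_
  have := hlogε.ne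
  rw [hc]
  field_simp

end GaussianMatrixLaw

theorem theorem2p4 (n : ℕ) (hn : 1 ≤ n)
    (A : Matrix (Fin n) (Fin n) ℝ) (hA : ∀ i j, 0 ≤ A i j)
    {Ω : Type*} [MeasurableSpace Ω] (P : Measure Ω) [IsProbabilityMeasure P]
    (u : Fin n → Fin n → Ω → ℝ)
    (hlaw : ∀ i j, HasLaw (u i j) (gaussianReal 0 1) P)
    (hindep : iIndepFun (fun (p : Fin n × Fin n) => u p.1 p.2) P) :
    -- the expectation of `α` exists and equals `per A`
    (Integrable (fun ω => permEstimator A (fun i j => u i j ω)) P ∧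
      ∫ ω, permEstimator A (fun i j => u i j ω) ∂P = A.permanent) ∧
    -- the upper tail
    (0 < A.permanent → ∀ C : ℝ, 1 < C →
      P.real {ω | C * A.permanent ≤ permEstimator A (fun i j => u i j ω)} ≤ C⁻¹) ∧
    -- the integral defining `c₀` converges, and the numerical value of `c₀`
    (IntegrableOn logGaussianIntegrand (Set.Ioi 0) volume ∧
      |permConstant - 0.2807297419| < 1 / 10 ^ 9) ∧
    -- the lower tail
    (0 < A.permanent → ∀ ε : ℝ, 0 < ε → ε < 1 →
      P.real {ω | permEstimator A (fun i j => u i j ω) ≤ (ε * permConstant) ^ n * A.permanent}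
        ≤ 8 / (n * Real.log ε ^ 2)) := by
  have hu := hasLaw_gaussianMatrix hlaw hindep
  exact ⟨⟨integrable_permEstimator hA hu, integral_permEstimator hA hu⟩,
    fun hper C hC => measureReal_le_permEstimator_le hA hper hu (by linarith),
    ⟨integrableOn_logGaussianIntegrand, abs_permConstant_sub_lt⟩,
    fun hper ε hε hε1 => measureReal_permEstimator_le_le hn hA hper hu hε hε1⟩
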